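/- Let $f:\mathbb{R}^d\to\mathbb{R}\cup\{+\infty\}$ be proper, closed (lower semicontinuous) and convex with a minimizer $x^\star$, and let $\lambda>0$. Put $\mathrm{Prox}_{\lambda f}(x)=\arg\min_{y}\{f(y)+\frac{1}{2\lambda}\|y-x\|^2\}$. For a schedule $(\alpha_0,\dots,\alpha_{N-1})$ of positive numbers, the relaxed proximal point algorithm (RPPA) started at $x^0\in\mathbb{R}^d$ computes $z^k=\mathrm{Prox}_{\lambda f}(x^k)$ and $x^{k+1}=x^k+\alpha_k(z^k-x^k)$ for $0\le k\le N-1$, and outputs $z^N=\mathrm{Prox}_{\lambda f}(x^N)$. Let $\rho=1+\sqrt2$. The silver schedules $\pi^{(m)}\in\mathbb{R}^{2^m-1}$ are defined by letting $\pi^{(0)}$ be empty, $\pi^{(1)}=[\sqrt2]$ and $\pi^{(m+1)}=[\pi^{(m)},\,1+\rho^{m-1},\,\pi^{(m)}]$ for $m\ge1$. For $m\ge0$ let $\gamma_m=\frac12\bigl(1+\sqrt{1+4\rho^m}\bigr)$, let $\overline{\pi}^{(m)}=[\pi^{(m)},\gamma_m]\in\mathbb{R}^{2^m}$ be the right silver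 schedule, and let $T_m=1+\gamma_m+\sum_{i}\pi^{(m)}_i$. Theorem. For every $m\ge0$, $\gamma_m>0$, $\gamma_m^2=\gamma_m+\rho^m$ and $T_m=\gamma_m+\rho^m$. For every $m\ge 0$, with $N=2^m$, for all $d$, $f$, $\lambda$, $x^\star$ as above and every $x^0\in\mathbb{R}^d$, RPPA with schedule $\overline{\pi}^{(m)}$ can be run from $x^0$ (the proximal points exist), and the sequence it generates satisfies $$f(z^N)-f(x^\star)\le\frac{1}{2T_m}\,\frac{1}{2\lambda}\,\|x^0-x^\star\|^2 ,$$ where, as $m\to\infty$ with $N=2^m$, $T_m\sim N^{\log_2\rho}$, and hence the right-hand side is $\sim\frac{1}{2N^{\log_2\rho}}\frac{1}{2\lambda}\|x^0-x^\star\|^2$ for fixed $\lambda$ and $\|x^0-x^\star\|$. The bound is tight: for all $m\ge0$, $d\ge1$, $\lambda>0$ and all $x^0\ne x^\star$ in $\mathbb{R}^d$ there is a proper, closed, convex $f$ with minimizer $x^\star$ for which RPPA with schedule $\overline{\pi}^{(m)}$ started at $x^0$ attains equality. -/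

import Mathlib

/-- An extended-real-valued function is proper: never `-∞`, and not identically `+∞`. -/
def IsProperFun {d : ℕ} (f : EuclideanSpace ℝ (Fin d) → EReal) : Prop :=
  (∀ x, f x ≠ ⊥) ∧ ∃ x, f x ≠ ⊤

/-- Convexity of an extended-real-valued function: its epigraph is convex. -/
def IsConvexFun {d : ℕ} (f : EuclideanSpace ℝ (Fin d) → EReal) : Prop :=
  Convex ℝ {p : EuclideanSpace ℝ (Fin d) × ℝ | f p.1 ≤ (p.2 : EReal)}

/-- Proper, closed (lower semicontinuous) and convex. -/
structure IsProperClosedConvex {d : ℕ} (f : EuclideanSpace ℝ (Fin d) → EReal) : Prop where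
  proper : IsProperFun f
  closed : LowerSemicontinuous f
  convex : IsConvexFun f

/-- `z = Prox_{lam f}(x)`, that is, `z` minimizes `y ↦ f y + (1 / (2 lam)) ‖y - x‖ ^ 2`. -/
def IsProx {d : ℕ} (f : EuclideanSpace ℝ (Fin d) → EReal) (lam : ℝ)
    (x z : EuclideanSpace ℝ (Fin d)) : Prop :=
  IsMinOn (fun y => f y + ((1 / (2 * lam) * ‖y - x‖ ^ 2 : ℝ) : EReal)) Set.univ z

/-- `(x k, z k)`, `0 ≤ k ≤ N`, is generated by the relaxed proximal point algorithm for `f` with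
proximal parameter `lam` and relaxation schedule `α` of length `N`, from the starting point `x0`.
The values of `x` and `z` at indices larger than `N` are irrelevant. -/
structure IsRPPA {d : ℕ} (f : EuclideanSpace ℝ (Fin d) → EReal) (lam : ℝ) (α : List ℝ)
    (x0 : EuclideanSpace ℝ (Fin d)) (x z : ℕ → EuclideanSpace ℝ (Fin d)) : Prop where
  init : x 0 = x0
  prox : ∀ k, k ≤ α.length → IsProx f lam (x k) (z k)
  relax : ∀ (k : ℕ) (hk : k < α.length), x (k + 1) = x k + α[k] • (z k - x k)

/-- The silver ratio `ρ = 1 + √2`. -/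
noncomputable def silverRho : ℝ := 1 + √2

/-- The silver stepsize schedule `π^(m)`, of length `2 ^ m - 1` (empty for `m = 0`). -/
noncomputable def silver : ℕ → List ℝ
  | 0 => []
  | 1 => [√2]
  | m + 2 => silver (m + 1) ++ [1 + silverRho ^ m] ++ silver (m + 1)

/-- `γ_m`, the positive root of `γ ^ 2 = γ + ρ ^ m`. -/
noncomputable def silverGamma (m : ℕ) : ℝ := (1 + √(1 + 4 * silverRho ^ m)) / 2

/-- The right silver stepsize schedule `[π^(m), γ_m]`; for `m = 0` it is `[γ_0]`. -/
noncomputable def rightSilver (m : ℕ) : List ℝ := silver m ++ [silverGamma m]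

/-- `T_m = 1 + γ_m + ∑ π^(m)_i`. -/
noncomputable def silverT (m : ℕ) : ℝ := 1 + silverGamma m + (silver m).sum

theorem silver_length (m : ℕ) : (silver m).length + 1 = 2 ^ m := by
  induction m using Nat.strong_induction_on with
  | _ m ih =>
    match m with
    | 0 => simp [silver]
    | 1 => simp [silver]
    | m + 2 =>
      have h := ih (m + 1) (by omega)
      simp only [silver, List.length_append, List.length_singleton]
      rw [pow_succ 2 (m + 1)]
      omega

/-- The right silver schedule has `N = 2 ^ m` steps. -/
theorem rightSilver_length (m : ℕ) : (rightSilver m).length = 2 ^ m := by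
  simp [rightSilver, silver_length]

/-! Replace `f` by `lam * f` and put `g k = x k - z k`. Then `g k` is a subgradient at `z k = x k -
g k`, and RPPA becomes `x (k + 1) = x k - α k • g k`; only the affine minorants at the `z k` matter.
The upper bound rests on a quadratic inequality (`IsPrimitiveSchedule`) that survives gluing. If `α`
satisfies it and `r = α.sum + 1`, then so does `α, 1 + r / ρ, α`, and `r` becomes `ρ * r`
(`IsPrimitiveSchedule.compose`). The empty schedule satisfies it, so every silver schedule does,
with `r = ρ ^ m`. The last step `γ` is absorbed by one more square, which closes exactly when `γ ^ 2
= γ + r`. Equality holds for a multiple of the norm centred at `xstar`: all iterates stay on the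
segment from `x0` to `xstar`, and the slope is tuned so that the output is its midpoint. -/

open scoped RealInnerProductSpace

/-! ### Subgradient inequalities that compose under concatenation -/

section Primitive

variable {E : Type*} [NormedAddCommGroup E] [InnerProductSpace ℝ E]

/-- `x` is generated by the steps `x (k + 1) = x k - α[k] • g k`. -/
def IsStepSequence (α : List ℝ) (x g : ℕ → E) : Prop :=
  ∀ k < α.length, x (k + 1) = x k - α.getD k 0 • g k

/-- `g j` is a subgradient at `x j - g j`, with value `f j`, of a convex function that is at most
`φ` at the point `p`, for all `j ≤ n`. -/
def IsSupportedAt (n : ℕ) (x g : ℕ → E) (f : ℕ → ℝ) (p : E) (φ : ℝ) : Prop :=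
  ∀ j ≤ n, f j + ⟪g j, p - (x j - g j)⟫ ≤ φ

/-- A schedule is primitive if it satisfies the inequality that composes under concatenation. -/
def IsPrimitiveSchedule (E : Type*) [NormedAddCommGroup E] [InnerProductSpace ℝ E]
    (α : List ℝ) : Prop :=
  ∀ (x g : ℕ → E) (f : ℕ → ℝ), IsStepSequence α x g →
    (∀ i ≤ α.length, IsSupportedAt α.length x g f (x i - g i) (f i)) →
    ∑ j ∈ Finset.range α.length,
        α.getD j 0 * (f α.length - f j + ⟪g j, x j - g j - x 0⟫) +
      α.sum * (α.sum + 2) / 2 * ‖g α.length‖ ^ 2 + ‖x 0 - x α.length‖ ^ 2 / 2 ≤ 0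

theorem List.sum_range_getD (α : List ℝ) :
    ∑ j ∈ Finset.range α.length, α.getD j 0 = α.sum := by
  induction α with
  | nil => simp
  | cons a l ih => simp [Finset.sum_range_succ', ← ih, add_comm]

theorem IsStepSequence.sub_eq {α : List ℝ} {x g : ℕ → E} (h : IsStepSequence α x g) :
    x 0 - x α.length = ∑ j ∈ Finset.range α.length, α.getD j 0 • g j := by
  rw [← neg_sub, ← Finset.sum_range_sub, ← Finset.sum_neg_distrib]
  refine Finset.sum_congr rfl fun j hj => ?_
  rw [h j (Finset.mem_range.1 hj)]
  abel

theorem IsStepSequence.sum_inner {α : List ℝ} {x g : ℕ → E} (h : IsStepSequence α x g) (v : E) :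
    ∑ j ∈ Finset.range α.length, α.getD j 0 * ⟪g j, v⟫ = ⟪x 0 - x α.length, v⟫ := by
  rw [h.sub_eq, _root_.sum_inner]
  simp only [real_inner_smul_left]

/-- Add to the primitive inequality the minorants at `p`, with weight `α j` for `j < n` and a free
weight `c` for the last one. The values `f j` with `j < n` cancel, and the `g j` sum to `x 0 - x n`,
so squares can be completed. -/
theorem IsPrimitiveSchedule.supported {α : List ℝ} (hα : IsPrimitiveSchedule E α)
    (hpos : ∀ a ∈ α, 0 ≤ a) {x g : ℕ → E} {f : ℕ → ℝ} (hx : IsStepSequence α x g)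
    (hf : ∀ i ≤ α.length, IsSupportedAt α.length x g f (x i - g i) (f i))
    {p : E} {φ c : ℝ} (hc : 0 ≤ c) (hp : IsSupportedAt α.length x g f p φ) :
    0 ≤ (α.sum + c) * (φ - f α.length - ‖g α.length‖ ^ 2 / 2) + ‖x 0 - p‖ ^ 2 / 2 -
      ‖x α.length - c • g α.length - p‖ ^ 2 / 2 +
      (c ^ 2 - c - α.sum * (α.sum + 1)) / 2 * ‖g α.length‖ ^ 2 := by
  have h1 := hα x g f hx hf
  have h2 : ∑ j ∈ Finset.range α.length,
      α.getD j 0 * (f j + ⟪g j, p - (x j - g j)⟫) ≤ α.sum * φ := by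
    rw [← List.sum_range_getD, Finset.sum_mul]
    refine Finset.sum_le_sum fun j hj => mul_le_mul_of_nonneg_left
      (hp j (Finset.mem_range.1 hj).le) ?_
    rw [List.getD_eq_getElem _ _ (Finset.mem_range.1 hj)]
    exact hpos _ (List.getElem_mem _)
  have h3 := mul_le_mul_of_nonneg_left (hp _ le_rfl) hc
  have h4 : ∑ j ∈ Finset.range α.length,
        α.getD j 0 * (f α.length - f j + ⟪g j, x j - g j - x 0⟫) +
      ∑ j ∈ Finset.range α.length, α.getD j 0 * (f j + ⟪g j, p - (x j - g j)⟫) =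
      α.sum * f α.length + ⟪x 0 - x α.length, p - x 0⟫ := by
    rw [← hx.sum_inner, ← List.sum_range_getD, Finset.sum_mul, ← Finset.sum_add_distrib,
      ← Finset.sum_add_distrib]
    refine Finset.sum_congr rfl fun j _ => ?_
    simp only [inner_sub_right]
    ring
  generalize ∑ j ∈ Finset.range α.length,
    α.getD j 0 * (f α.length - f j + ⟪g j, x j - g j - x 0⟫) = S at *
  generalize ∑ j ∈ Finset.range α.length, α.getD j 0 * (f j + ⟪g j, p - (x j - g j)⟫) = S' at *
  have key : (α.sum + c) * (φ - f α.length - ‖g α.length‖ ^ 2 / 2) + ‖x 0 - p‖ ^ 2 / 2 -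
      ‖x α.length - c • g α.length - p‖ ^ 2 / 2 +
      (c ^ 2 - c - α.sum * (α.sum + 1)) / 2 * ‖g α.length‖ ^ 2 =
      (α.sum * φ - S') +
      (c * φ - c * (f α.length + ⟪g α.length, p - (x α.length - g α.length)⟫)) -
      (S + α.sum * (α.sum + 2) / 2 * ‖g α.length‖ ^ 2 + ‖x 0 - x α.length‖ ^ 2 / 2) := by
    rw [← sub_eq_zero]
    simp only [← real_inner_self_eq_norm_sq, inner_sub_left, inner_sub_right,
      real_inner_smul_left, real_inner_smul_right] at h4 ⊢
    rw [real_inner_comm (x 0) p, real_inner_comm (x 0) (x α.length), real_inner_comm p (x α.length),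
      real_inner_comm p (g α.length), real_inner_comm (x α.length) (g α.length)] at *
    linear_combination h4
  rw [key]
  linarith

/-- Concatenation of two copies of a primitive schedule, with the silver step in between. -/
theorem IsPrimitiveSchedule.compose {α : List ℝ} (hα : IsPrimitiveSchedule E α)
    (hpos : ∀ a ∈ α, 0 ≤ a) {r : ℝ} (hr : α.sum + 1 = r) :
    IsPrimitiveSchedule E (α ++ [1 + r * (√2 - 1)] ++ α) := by
  intro x g f hx hf
  have hr0 : 0 ≤ r := by have := List.sum_nonneg hpos; linarith
  set n := α.length with hn
  set β := 1 + r * (√2 - 1) with hβ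
  have hlen : (α ++ [β] ++ α).length = n + 1 + n := by simp [hn]; omega
  rw [hlen] at hf
  have hg1 : ∀ j < n, (α ++ [β] ++ α).getD j 0 = α.getD j 0 := fun j hj => by
    rw [List.getD_append _ _ _ _ (by simp; omega), List.getD_append _ _ _ _ hj]
  have hg2 : (α ++ [β] ++ α).getD n 0 = β := by
    rw [List.getD_append _ _ _ _ (by simp; omega), List.getD_append_right _ _ _ _ le_rfl]
    simp
  have hg3 : ∀ j, (α ++ [β] ++ α).getD (n + 1 + j) 0 = α.getD j 0 := fun j => by
    rw [List.getD_append_right _ _ _ _ (by simp; omega)]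
    congr 1
    simp; omega
  have hx1 : IsStepSequence α x g := fun k hk => by
    rw [hx k (by rw [hlen]; omega), hg1 k hk]
  have hxn : x (n + 1) = x n - β • g n := by rw [hx n (by rw [hlen]; omega), hg2]
  have hx2 : IsStepSequence α (fun k => x (n + 1 + k)) (fun k => g (n + 1 + k)) := fun k hk => by
    have := hx (n + 1 + k) (by rw [hlen]; omega)
    rw [hg3] at this
    exact this
  have hf1 : ∀ i ≤ n, IsSupportedAt n x g f (x i - g i) (f i) := fun i hi j hj =>
    hf i (by omega) j (by omega)
  have hf2 : ∀ i ≤ n + 1 + n, IsSupportedAt n (fun k => x (n + 1 + k)) (fun k => g (n + 1 + k))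
      (fun k => f (n + 1 + k)) (x i - g i) (f i) := fun i hi j hj => hf i hi _ (by omega)
  have P1 := hα x g f hx1 hf1
  have P2 := hα _ _ _ hx2 fun i hi => hf2 (n + 1 + i) (by omega)
  -- The second copy is tested at the two proximal points `z n` (with `c = 1`) and `z (n + 1 + n)`
  -- (with `c = 0`); in the latter case the function values cancel.
  have D1 := hα.supported hpos hx2 (fun i hi => hf2 (n + 1 + i) (by omega)) zero_le_one
    (hf2 n (by omega))
  have D2 := hα.supported hpos hx2 (fun i hi => hf2 (n + 1 + i) (by omega)) le_rfl
    (hf2 (n + 1 + n) le_rfl)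
  have Q := hf (n + 1 + n) le_rfl n (by omega)
  have hs := hx2.sum_inner (x (n + 1) - x 0)
  rw [hlen]
  simp only [← hn, add_zero] at P1 P2 D1 D2 hs
  -- Moving the base point of the second copy from `x (n + 1)` to `x 0`, and the reference value of
  -- the first from `f n` to the final one, brings in the two extra terms.
  have hsum : ∑ j ∈ Finset.range (n + 1 + n), (α ++ [β] ++ α).getD j 0 *
        (f (n + 1 + n) - f j + ⟪g j, x j - g j - x 0⟫) =
      (∑ j ∈ Finset.range n, α.getD j 0 * (f n - f j + ⟪g j, x j - g j - x 0⟫) +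
        α.sum * (f (n + 1 + n) - f n)) +
      β * (f (n + 1 + n) - f n + ⟪g n, x n - g n - x 0⟫) +
      (∑ j ∈ Finset.range n, α.getD j 0 * (f (n + 1 + n) - f (n + 1 + j) +
          ⟪g (n + 1 + j), x (n + 1 + j) - g (n + 1 + j) - x (n + 1)⟫) +
        ⟪x (n + 1) - x (n + 1 + n), x (n + 1) - x 0⟫) := by
    rw [Finset.sum_range_add, Finset.sum_range_succ, hg2]
    congr 1
    · congr 1
      rw [← List.sum_range_getD, Finset.sum_mul, ← Finset.sum_add_distrib]
      refine Finset.sum_congr rfl fun j hj => ?_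
      rw [hg1 j (Finset.mem_range.1 hj)]
      ring
    · rw [← hs, ← Finset.sum_add_distrib]
      refine Finset.sum_congr rfl fun j _ => ?_
      rw [hg3]
      simp only [inner_sub_right]
      ring
  rw [hsum]
  have hsum' : (α ++ [β] ++ α).sum = 2 * α.sum + β := by simp; ring
  rw [hsum']
  have hH : α.sum = r - 1 := by linarith
  rw [hH] at P1 P2 D1 D2 ⊢
  generalize ∑ j ∈ Finset.range n, α.getD j 0 * (f n - f j + ⟪g j, x j - g j - x 0⟫) = S1 at *
  generalize ∑ j ∈ Finset.range n, α.getD j 0 * (f (n + 1 + n) - f (n + 1 + j) +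
    ⟪g (n + 1 + j), x (n + 1 + j) - g (n + 1 + j) - x (n + 1)⟫) = S2 at *
  rw [hxn] at *
  generalize x 0 = X at *
  generalize x n = Y at *
  generalize x (n + 1 + n) = Z at *
  generalize g n = u at *
  generalize g (n + 1 + n) = v at *
  generalize f n = a at *
  generalize f (n + 1 + n) = b at *
  have hq2 : √2 ^ 2 = (2 : ℝ) := Real.sq_sqrt (by norm_num)
  have hq0 : 0 ≤ √2 := Real.sqrt_nonneg 2
  rw [hβ] at *
  generalize √2 = q at *
  -- Weights `ρ` on `D1`, `D2` and `r` on `Q` balance the values: `f n` receives `ρ * r - r = √2 * r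
  -- = α.sum + β`.
  have D1' := mul_nonneg (by linarith : 0 ≤ 1 + q) D1
  have D2' := mul_nonneg (by linarith : 0 ≤ 1 + q) D2
  have Q' := mul_le_mul_of_nonneg_left Q hr0
  simp only [← real_inner_self_eq_norm_sq, inner_sub_left, inner_sub_right,
      real_inner_smul_left, real_inner_smul_right] at P1 P2 D1' D2' Q' ⊢
  rw [real_inner_comm X Y, real_inner_comm X Z, real_inner_comm X u, real_inner_comm Y Z,
    real_inner_comm Y u, real_inner_comm Y v, real_inner_comm Z u, real_inner_comm Z v,
    real_inner_comm u v] at *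
  linear_combination P1 + P2 + D1' + D2' + Q' +
    (r * (-⟪Y, u⟫ + ⟪u, u⟫ + ⟪Z, u⟫ - ⟪u, v⟫) + r ^ 2 * ⟪u, u⟫ * (q - 1 / 2) +
      r ^ 2 * ⟪v, v⟫ / 2) * hq2

end Primitive

/-! ### Constants of the silver schedules and their asymptotics -/

theorem silverRho_pos : 0 < silverRho := by unfold silverRho; positivity

theorem silverRho_inv : silverRho⁻¹ = √2 - 1 := by
  have h : √2 ^ 2 = (2 : ℝ) := Real.sq_sqrt (by norm_num)
  refine inv_eq_of_mul_eq_one_right ?_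
  unfold silverRho
  linear_combination h

/-- With `ρ ^ (m - 1)` written as `ρ ^ m * (√2 - 1)`, the recursion takes the form used for gluing
and also covers `m = 0`. -/
theorem silver_succ (m : ℕ) :
    silver (m + 1) = silver m ++ [1 + silverRho ^ m * (√2 - 1)] ++ silver m := by
  cases m with
  | zero => simp [silver]
  | succ m =>
    rw [silver, ← silverRho_inv, pow_succ, mul_assoc, mul_inv_cancel₀ silverRho_pos.ne', mul_one]

theorem silver_nonneg (m : ℕ) : ∀ a ∈ silver m, 0 ≤ a := by
  induction m with
  | zero => simp [silver]
  | succ m ih =>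
    have h : 0 ≤ silverRho ^ m * (√2 - 1) := by
      rw [← silverRho_inv]
      have := silverRho_pos
      positivity
    intro a ha
    simp only [silver_succ, List.mem_append, List.mem_singleton] at ha
    rcases ha with (ha | rfl) | ha
    · exact ih a ha
    · linarith
    · exact ih a ha

theorem silver_sum (m : ℕ) : (silver m).sum + 1 = silverRho ^ m := by
  induction m with
  | zero => simp [silver]
  | succ m ih =>
    simp only [silver_succ, List.sum_append, List.sum_singleton, pow_succ]
    rw [← ih]
    unfold silverRho
    ring

theorem silverGamma_sq (m : ℕ) : silverGamma m ^ 2 = silverGamma m + silverRho ^ m := by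
  have h : √(1 + 4 * silverRho ^ m) ^ 2 = 1 + 4 * silverRho ^ m :=
    Real.sq_sqrt (by have := silverRho_pos; positivity)
  unfold silverGamma
  linear_combination h / 4

theorem silverGamma_pos (m : ℕ) : 0 < silverGamma m := by unfold silverGamma; positivity

theorem silverT_eq (m : ℕ) : silverT m = silverGamma m + silverRho ^ m := by
  rw [silverT, ← silver_sum]; ring

theorem silverT_pos (m : ℕ) : 0 < silverT m := by
  rw [silverT_eq]
  exact add_pos (silverGamma_pos m) (pow_pos silverRho_pos m)

theorem two_pow_rpow_logb_silverRho (m : ℕ) :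
    ((2 ^ m : ℕ) : ℝ) ^ Real.logb 2 silverRho = silverRho ^ m := by
  push_cast
  rw [← Real.rpow_natCast 2 m, ← Real.rpow_mul (by norm_num), mul_comm,
    Real.rpow_mul (by norm_num), Real.rpow_logb (by norm_num) (by norm_num) silverRho_pos,
    Real.rpow_natCast]

theorem silverGamma_isLittleO :
    silverGamma =o[Filter.atTop] fun m : ℕ => silverRho ^ m := by
  have hρ : ∀ m : ℕ, 0 < silverRho ^ m := fun m => pow_pos silverRho_pos m
  rw [Asymptotics.isLittleO_iff_tendsto fun m h => absurd h (hρ m).ne']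
  have h0 : Filter.Tendsto (fun m : ℕ => (silverRho⁻¹) ^ m) Filter.atTop (nhds 0) := by
    refine tendsto_pow_atTop_nhds_zero_of_lt_one (inv_nonneg.2 silverRho_pos.le)
      (inv_lt_one_of_one_lt₀ ?_)
    unfold silverRho
    simp
  -- This function at `t = ρ⁻¹ ^ m` is the quotient of `γ_m` by `ρ ^ m`.
  have h1 : Filter.Tendsto (fun t : ℝ => (t + √(t ^ 2 + 4 * t)) / 2) (nhds 0) (nhds 0) := by
    have : Continuous fun t : ℝ => (t + √(t ^ 2 + 4 * t)) / 2 := by fun_prop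
    simpa using this.tendsto 0
  refine (h1.comp h0).congr fun m => ?_
  have hm := hρ m
  simp only [Function.comp, silverGamma, inv_pow]
  generalize silverRho ^ m = r at hm
  have : 1 + 4 * r = r ^ 2 * (r⁻¹ ^ 2 + 4 * r⁻¹) := by field_simp
  rw [this, Real.sqrt_mul (by positivity), Real.sqrt_sq hm.le]
  field_simp

theorem silverT_isEquivalent : Asymptotics.IsEquivalent Filter.atTop silverT
    (fun m : ℕ => ((2 ^ m : ℕ) : ℝ) ^ Real.logb 2 silverRho) := by
  simp only [two_pow_rpow_logb_silverRho]
  refine silverGamma_isLittleO.congr_left fun m => ?_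
  simp [silverT_eq]

/-! ### Rate of the right silver schedule -/

theorem silver_isPrimitiveSchedule (E : Type*) [NormedAddCommGroup E] [InnerProductSpace ℝ E]
    (m : ℕ) : IsPrimitiveSchedule E (silver m) := by
  induction m with
  | zero => intro x g f _ _; simp [silver]
  | succ m ih =>
    rw [silver_succ]
    exact ih.compose (silver_nonneg m) (silver_sum m)

/-- The rate of the right silver schedule, in terms of subgradients at the proximal points. -/
theorem rightSilver_rate {E : Type*} [NormedAddCommGroup E] [InnerProductSpace ℝ E] (m : ℕ)
    {x g : ℕ → E} {f : ℕ → ℝ} (hx : IsStepSequence (rightSilver m) x g)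
    (hf : ∀ i ≤ 2 ^ m, IsSupportedAt (2 ^ m) x g f (x i - g i) (f i)) {p : E} {φ : ℝ}
    (hp : IsSupportedAt (2 ^ m) x g f p φ) :
    4 * silverT m * (f (2 ^ m) - φ) ≤ ‖x 0 - p‖ ^ 2 := by
  have hlen := silver_length m
  have hS : (silver m).sum = silverRho ^ m - 1 := by rw [← silver_sum]; ring
  have hr : 0 < silverRho ^ m := pow_pos silverRho_pos m
  have hγ := silverGamma_pos m
  have hγ2 := silverGamma_sq m
  rw [← hlen] at hf hp ⊢
  have hx1 : IsStepSequence (silver m) x g := fun k hk => by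
    rw [hx k (by rw [rightSilver_length]; omega), rightSilver, List.getD_append _ _ _ _ hk]
  -- With `c = r + 1`, where `r = ρ ^ m`, the total weight is `(r - 1) + c = 2 * r`. It matches the
  -- weight of `Q1` below, so the value at `z n` cancels.
  have D := (silver_isPrimitiveSchedule E m).supported (silver_nonneg m) hx1
    (fun i hi j hj => hf i (by omega) j (by omega)) (c := silverRho ^ m + 1) (by linarith)
    (fun j hj => hp j (by omega))
  have Q1 := hf (silver m).length (by omega) _ le_rfl
  have Q2 := hp _ le_rfl
  have hxn : x ((silver m).length + 1) =
      x (silver m).length - silverGamma m • g (silver m).length := by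
    rw [hx _ (by rw [rightSilver_length]; omega), rightSilver,
      List.getD_append_right _ _ _ _ le_rfl]
    simp
  have Q1' := mul_le_mul_of_nonneg_left Q1 (by positivity : 0 ≤ 2 * silverRho ^ m)
  have Q2' := mul_le_mul_of_nonneg_left Q2 (by positivity : 0 ≤ 2 * silverGamma m)
  -- This square absorbs the negative square in `D` and all terms in the last subgradient; the
  -- remainder is a multiple of `γ ^ 2 - γ - r`.
  have R := sq_nonneg ‖x (silver m).length - (silverRho ^ m + 1) • g (silver m).length - p -
    (2 * silverGamma m) • g ((silver m).length + 1)‖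
  rw [silverT_eq]
  rw [hS] at D
  rw [hxn] at Q1' Q2'
  generalize x 0 = X at *
  generalize x (silver m).length = Y at *
  generalize g (silver m).length = u at *
  generalize g ((silver m).length + 1) = v at *
  generalize silverRho ^ m = r at *
  generalize silverGamma m = γ at *
  simp only [← real_inner_self_eq_norm_sq, inner_sub_left, inner_sub_right,
      real_inner_smul_left, real_inner_smul_right] at D Q1' Q2' R ⊢
  rw [real_inner_comm v Y, real_inner_comm v u, real_inner_comm v p] at R
  linear_combination 2 * D + 2 * Q1' + 2 * Q2' + R + 4 * (⟪v, v⟫ - ⟪v, u⟫) * hγ2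

/-! ### Proximal points: existence, subgradients, and the upper bound -/

section Prox

variable {d : ℕ} {f : EuclideanSpace ℝ (Fin d) → EReal} {lam : ℝ}

theorem EReal.ne_top_of_add_coe_le {a b : EReal} {s t : ℝ} (h : a + s ≤ b + t) (hb : b ≠ ⊤) :
    a ≠ ⊤ := by
  rintro rfl
  rw [EReal.top_add_coe, top_le_iff] at h
  exact EReal.add_ne_top hb (EReal.coe_ne_top t) h

theorem IsProx.ne_top {x z : EuclideanSpace ℝ (Fin d)} (hf : IsProperFun f)
    (h : IsProx f lam x z) : f z ≠ ⊤ := by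
  obtain ⟨y, hy⟩ := hf.2
  exact EReal.ne_top_of_add_coe_le (h (Set.mem_univ y)) hy

theorem IsMinOn.ne_top_of_isProperFun {x : EuclideanSpace ℝ (Fin d)} (hf : IsProperFun f)
    (h : IsMinOn f Set.univ x) : f x ≠ ⊤ := by
  obtain ⟨y, hy⟩ := hf.2
  exact ne_top_of_le_ne_top hy (h (Set.mem_univ y))

/-- The proximal step is a subgradient step at the proximal point. -/
theorem IsProx.subgradient (hf : IsProperClosedConvex f) (hlam : 0 < lam)
    {x z y : EuclideanSpace ℝ (Fin d)} (h : IsProx f lam x z) (hy : f y ≠ ⊤) :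
    lam * (f z).toReal + ⟪x - z, y - z⟫ ≤ lam * (f y).toReal := by
  have hz := h.ne_top hf.proper
  lift f z to ℝ using ⟨hz, hf.proper.1 z⟩ with a ha
  lift f y to ℝ using ⟨hy, hf.proper.1 y⟩ with b hb
  simp only [EReal.toReal_coe]
  -- Compare `z` with `(1 - t) • z + t • y`, divide by `t`, then let `t` tend to `0` from the right.
  have key : ∀ t ∈ Set.Ioo (0 : ℝ) 1,
      0 ≤ lam * (b - a) - ⟪x - z, y - z⟫ + t * (‖y - z‖ ^ 2 / 2) := by
    rintro t ⟨ht0, ht1⟩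
    have hc := hf.convex (x := (z, a)) (y := (y, b)) ha.ge hb.ge (sub_nonneg.2 ht1.le) ht0.le
      (by ring)
    simp only [Set.mem_ofPred_eq, Prod.fst_add, Prod.snd_add, Prod.smul_fst, Prod.smul_snd,
      smul_eq_mul] at hc
    have h1 : f z + ((1 / (2 * lam) * ‖z - x‖ ^ 2 : ℝ) : EReal) ≤ f ((1 - t) • z + t • y) +
      ((1 / (2 * lam) * ‖(1 - t) • z + t • y - x‖ ^ 2 : ℝ) : EReal) := h (Set.mem_univ _)
    have h2 := h1.trans (add_le_add_left hc _)
    rw [← ha] at h2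
    norm_cast at h2
    have h3 : ‖(1 - t) • z + t • y - x‖ ^ 2 =
        ‖z - x‖ ^ 2 - 2 * t * ⟪x - z, y - z⟫ + t ^ 2 * ‖y - z‖ ^ 2 := by
      have : (1 - t) • z + t • y - x = t • (y - z) - (x - z) := by module
      rw [this, norm_sub_sq_real, norm_smul, real_inner_smul_left, mul_pow, Real.norm_eq_abs,
        sq_abs, norm_sub_rev z x, real_inner_comm]
      ring
    rw [h3] at h2
    have h4 := mul_le_mul_of_nonneg_left h2 hlam.le
    have h5 : 0 ≤ t * (lam * (b - a) - ⟪x - z, y - z⟫ + t * (‖y - z‖ ^ 2 / 2)) := by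
      field_simp at h4 ⊢
      linarith
    exact nonneg_of_mul_nonneg_right h5 ht0
  have hlim : Filter.Tendsto
      (fun t : ℝ => lam * (b - a) - ⟪x - z, y - z⟫ + t * (‖y - z‖ ^ 2 / 2))
      (nhdsWithin 0 (Set.Ioi 0)) (nhds (lam * (b - a) - ⟪x - z, y - z⟫ + 0 * (‖y - z‖ ^ 2 / 2))) :=
    Filter.Tendsto.mono_left (Continuous.tendsto (by fun_prop) 0) nhdsWithin_le_nhds
  have := ge_of_tendsto hlim (Filter.mem_of_superset (Ioo_mem_nhdsGT one_pos) key)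
  linarith

/-- Outside the closed ball about `x` through `xstar`, both terms of the objective are at least
their values at `xstar`, so minimizing over this compact ball suffices. -/
theorem IsProperClosedConvex.exists_isProx (hf : IsProperClosedConvex f) (hlam : 0 < lam)
    {xstar : EuclideanSpace ℝ (Fin d)} (hmin : IsMinOn f Set.univ xstar)
    (x : EuclideanSpace ℝ (Fin d)) : ∃ z, IsProx f lam x z := by
  have hlsc : LowerSemicontinuous
      (fun y => f y + ((1 / (2 * lam) * ‖y - x‖ ^ 2 : ℝ) : EReal)) := by
    refine LowerSemicontinuous.add' hf.closed ?_ fun y => ?_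
    · exact (continuous_coe_real_ereal.comp (by fun_prop)).lowerSemicontinuous
    · exact EReal.continuousAt_add (Or.inr (EReal.coe_ne_bot _)) (Or.inr (EReal.coe_ne_top _))
  obtain ⟨z, hz, hzmin⟩ := (hlsc.lowerSemicontinuousOn _).exists_isMinOn
    (s := Metric.closedBall x ‖xstar - x‖) ⟨xstar, by simp [dist_eq_norm]⟩
    (isCompact_closedBall _ _)
  refine ⟨z, fun y _ => ?_⟩
  by_cases hy : y ∈ Metric.closedBall x ‖xstar - x‖
  · exact hzmin hy
  · refine (hzmin (a := xstar) (by simp [dist_eq_norm])).trans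
      (add_le_add (hmin (Set.mem_univ y)) (EReal.coe_le_coe ?_))
    rw [Metric.mem_closedBall, dist_eq_norm, not_le] at hy
    gcongr

theorem exists_isRPPA (h : ∀ x, ∃ z, IsProx f lam x z) (α : List ℝ)
    (x0 : EuclideanSpace ℝ (Fin d)) :
    ∃ x z : ℕ → EuclideanSpace ℝ (Fin d), IsRPPA f lam α x0 x z := by
  choose P hP using h
  let x : ℕ → EuclideanSpace ℝ (Fin d) := fun k =>
    Nat.rec x0 (fun k y => y + α.getD k 0 • (P y - y)) k
  refine ⟨x, fun k => P (x k), rfl, fun k _ => hP _, fun k hk => ?_⟩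
  rw [← List.getD_eq_getElem α 0 hk]

theorem IsRPPA.rate {m : ℕ} {x0 xstar : EuclideanSpace ℝ (Fin d)}
    {x z : ℕ → EuclideanSpace ℝ (Fin d)} (h : IsRPPA f lam (rightSilver m) x0 x z)
    (hf : IsProperClosedConvex f) (hlam : 0 < lam) (hmin : IsMinOn f Set.univ xstar) :
    f (z (2 ^ m)) - f xstar ≤
      ((1 / (2 * silverT m) * (1 / (2 * lam)) * ‖x0 - xstar‖ ^ 2 : ℝ) : EReal) := by
  have hlen := rightSilver_length m
  have hz : ∀ k ≤ 2 ^ m, f (z k) ≠ ⊤ := fun k hk => (h.prox k (by omega)).ne_top hf.proper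
  have hs := hmin.ne_top_of_isProperFun hf.proper
  have hsub : ∀ y, f y ≠ ⊤ → IsSupportedAt (2 ^ m) x (fun k => x k - z k)
      (fun k => lam * (f (z k)).toReal) y (lam * (f y).toReal) := fun y hy j hj => by
    simpa using (h.prox j (by omega)).subgradient hf hlam hy
  have := rightSilver_rate m (x := x) (g := fun k => x k - z k)
    (f := fun k => lam * (f (z k)).toReal) (fun k hk => ?_)
    (fun i hi => by simpa using hsub (z i) (hz i hi)) (hsub xstar hs)
  · rw [h.init] at this
    have hT := silverT_pos m
    rw [← EReal.coe_toReal (hz _ le_rfl) (hf.proper.1 _), ← EReal.coe_toReal hs (hf.proper.1 _)]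
    norm_cast
    field_simp
    linarith
  · rw [h.relax k hk, List.getD_eq_getElem _ _ hk, ← neg_sub, smul_neg, ← sub_eq_add_neg]

end Prox

/-! ### Tightness: a multiple of the norm -/

section Tightness

variable {d : ℕ}

theorem isProperClosedConvex_norm {L : ℝ} (hL : 0 ≤ L) (p : EuclideanSpace ℝ (Fin d)) :
    IsProperClosedConvex fun y => ((L * ‖y - p‖ : ℝ) : EReal) where
  proper := ⟨fun x => EReal.coe_ne_bot _, p, EReal.coe_ne_top _⟩
  closed := (continuous_coe_real_ereal.comp (by fun_prop)).lowerSemicontinuous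
  convex := by
    have : ConvexOn ℝ Set.univ fun y : EuclideanSpace ℝ (Fin d) => L * ‖y - p‖ := by
      have := ((convexOn_univ_norm (E := EuclideanSpace ℝ (Fin d))).translate_left (-p)).smul hL
      simpa [Function.comp_def, sub_eq_add_neg] using this
    simpa only [IsConvexFun, EReal.coe_le_coe_iff, Set.mem_univ, true_and] using
      this.convex_epigraph

/-- Up to the factor `lam`, the objective exceeds its value at `p + θ • w` by `‖y - p - θ • w‖ ^ 2 /
2` plus `τ` times the Cauchy–Schwarz slack of `y - p` and `w`. -/
theorem isProx_norm {lam τ θ : ℝ} (hlam : 0 < lam) (hτ : 0 ≤ τ) (hθ : 0 ≤ θ)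
    (p w : EuclideanSpace ℝ (Fin d)) :
    IsProx (fun y => ((τ / lam * ‖w‖ * ‖y - p‖ : ℝ) : EReal)) lam
      (p + (θ + τ) • w) (p + θ • w) := by
  intro y _
  simp only [Set.mem_ofPred_eq]
  norm_cast
  have h1 : p + θ • w - (p + (θ + τ) • w) = -(τ • w) := by module
  have h2 : y - (p + (θ + τ) • w) = (y - p) - (θ + τ) • w := by module
  rw [h1, h2, add_sub_cancel_left, norm_neg, norm_sub_sq_real, norm_smul, norm_smul, norm_smul,
    real_inner_smul_right, Real.norm_of_nonneg hτ, Real.norm_of_nonneg hθ,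
    Real.norm_of_nonneg (add_nonneg hθ hτ)]
  have h3 := mul_le_mul_of_nonneg_left (real_inner_le_norm (y - p) w) hτ
  have h4 := sq_nonneg ‖y - p - θ • w‖
  rw [norm_sub_sq_real, norm_smul, Real.norm_of_nonneg hθ, real_inner_smul_right] at h4
  field_simp
  linarith

theorem rightSilver_tight (m : ℕ) {lam : ℝ} (x0 xstar : EuclideanSpace ℝ (Fin d))
    (hlam : 0 < lam) :
    ∃ f : EuclideanSpace ℝ (Fin d) → EReal,
      IsProperClosedConvex f ∧ IsMinOn f Set.univ xstar ∧
      ∃ x z : ℕ → EuclideanSpace ℝ (Fin d), IsRPPA f lam (rightSilver m) x0 x z ∧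
        f (z (2 ^ m)) - f xstar =
          ((1 / (2 * silverT m) * (1 / (2 * lam)) * ‖x0 - xstar‖ ^ 2 : ℝ) : EReal) := by
  have hT := silverT_pos m
  -- With slope `τ / lam * ‖w‖`, the final value is `τ * (1 - silverT m * τ) * ‖w‖ ^ 2 / lam`, which
  -- this `τ` maximizes.
  set τ := 1 / (2 * silverT m) with hτ
  have hτ0 : 0 < τ := by positivity
  set w := x0 - xstar with hw
  have hlen := rightSilver_length m
  have hsum : (rightSilver m).sum + 1 = silverT m := by
    rw [silverT, rightSilver, List.sum_append, List.sum_singleton]; ring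
  have hpos : ∀ a ∈ rightSilver m, 0 ≤ a := by
    intro a ha
    rw [rightSilver, List.mem_append, List.mem_singleton] at ha
    rcases ha with ha | rfl
    · exact silver_nonneg m a ha
    · exact (silverGamma_pos m).le
  set s : ℕ → ℝ := fun k => ((rightSilver m).take k).sum with hs
  -- This keeps every proximal point from passing beyond `xstar`.
  have hsT : ∀ k, s k + 1 ≤ silverT m := fun k => by
    have h1 : 0 ≤ ((rightSilver m).drop k).sum :=
      List.sum_nonneg fun a ha => hpos a (List.mem_of_mem_drop ha)
    have h2 := List.sum_take_add_sum_drop (rightSilver m) k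
    simp only [hs]
    linarith
  have hτT : τ * silverT m = 1 / 2 := by rw [hτ]; field_simp
  have hθ : ∀ k, 0 ≤ 1 - (s k + 1) * τ := fun k => by
    have := mul_le_mul_of_nonneg_right (hsT k) hτ0.le
    linarith
  refine ⟨_, isProperClosedConvex_norm (L := τ / lam * ‖w‖) (by positivity) xstar, fun y _ => ?_,
    fun k => xstar + (1 - (s k + 1) * τ + τ) • w, fun k => xstar + (1 - (s k + 1) * τ) • w,
    ⟨?_, fun k _ => isProx_norm hlam hτ0.le (hθ k) xstar w, fun k hk => ?_⟩, ?_⟩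
  · simp only [Set.mem_ofPred_eq, sub_self, norm_zero, mul_zero]
    exact EReal.coe_le_coe (by positivity)
  · simp [hs, hw]
  · have : s (k + 1) = s k + (rightSilver m)[k] := List.sum_take_succ _ _ hk
    rw [this]
    module
  · have hsN : s (2 ^ m) = (rightSilver m).sum := by
      simp only [hs]; rw [List.take_of_length_le hlen.le]
    -- The output is the midpoint of `x0` and `xstar`.
    have h12 : 1 - (s (2 ^ m) + 1) * τ = 1 / 2 := by rw [hsN, hsum]; linarith
    beta_reduce
    rw [h12, add_sub_cancel_left, norm_smul, sub_self, norm_zero]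
    norm_cast
    norm_num
    field_simp

end Tightness

theorem mainTheorem3 :
    -- the constants: `γ_m`, `T_m`, and `T_m ∼ N ^ (log₂ ρ)` for `N = 2 ^ m`
    (∀ m : ℕ, 0 < silverGamma m ∧ silverGamma m ^ 2 = silverGamma m + silverRho ^ m ∧
      silverT m = silverGamma m + silverRho ^ m) ∧
    Asymptotics.IsEquivalent Filter.atTop silverT
      (fun m : ℕ => ((2 ^ m : ℕ) : ℝ) ^ Real.logb 2 silverRho) ∧
    (∀ R lam : ℝ, 0 < lam → Asymptotics.IsEquivalent Filter.atTop
      (fun m : ℕ => 1 / (2 * silverT m) * (1 / (2 * lam)) * R ^ 2)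
      (fun m : ℕ => 1 / (2 * ((2 ^ m : ℕ) : ℝ) ^ Real.logb 2 silverRho) *
        (1 / (2 * lam)) * R ^ 2)) ∧
    -- the algorithm can be run, and every run satisfies the upper bound
    (∀ (m d : ℕ) (f : EuclideanSpace ℝ (Fin d) → EReal) (lam : ℝ)
      (x0 xstar : EuclideanSpace ℝ (Fin d)),
      IsProperClosedConvex f → 0 < lam → IsMinOn f Set.univ xstar →
      (∃ x z : ℕ → EuclideanSpace ℝ (Fin d), IsRPPA f lam (rightSilver m) x0 x z) ∧
      ∀ x z : ℕ → EuclideanSpace ℝ (Fin d), IsRPPA f lam (rightSilver m) x0 x z →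
        f (z (2 ^ m)) - f xstar ≤
          ((1 / (2 * silverT m) * (1 / (2 * lam)) * ‖x0 - xstar‖ ^ 2 : ℝ) : EReal)) ∧
    -- tightness: the bound is attained
    (∀ (m d : ℕ) (lam : ℝ) (x0 xstar : EuclideanSpace ℝ (Fin d)), 0 < lam → x0 ≠ xstar →
      ∃ f : EuclideanSpace ℝ (Fin d) → EReal,
        IsProperClosedConvex f ∧ IsMinOn f Set.univ xstar ∧
        ∃ x z : ℕ → EuclideanSpace ℝ (Fin d), IsRPPA f lam (rightSilver m) x0 x z ∧
          f (z (2 ^ m)) - f xstar =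
            ((1 / (2 * silverT m) * (1 / (2 * lam)) * ‖x0 - xstar‖ ^ 2 : ℝ) : EReal)) := by

  refine ⟨fun m => ⟨silverGamma_pos m, silverGamma_sq m, silverT_eq m⟩, silverT_isEquivalent,
    fun R lam _ => ?_, fun m d f lam x0 xstar hf hlam hmin => ⟨exists_isRPPA
      (hf.exists_isProx hlam hmin) _ _, fun x z h => h.rate hf hlam hmin⟩,
    fun m d lam x0 xstar hlam _ => rightSilver_tight m x0 xstar hlam⟩
  have h2 : Asymptotics.IsEquivalent Filter.atTop (fun _ : ℕ => (2 : ℝ)) fun _ => 2 := .refl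
  have h3 : Asymptotics.IsEquivalent Filter.atTop (fun _ : ℕ => 1 / (2 * lam) * R ^ 2)
    fun _ => 1 / (2 * lam) * R ^ 2 := .refl
  simpa [Pi.mul_def, Pi.inv_def, mul_assoc] using (h2.mul silverT_isEquivalent).inv.mul h3
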